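/- **Theorem 2.2.** Let $\gamma>1$, $\alpha>\tfrac12$, $\rho_\pm>0$, $m_\pm\in\mathbb R$, $u_\pm=m_\pm/\rho_\pm$, $p(\rho)=\rho^\gamma$. Put $$\lambda_2(\rho,u)=u+\sqrt{p'(\rho)},\qquad \Sigma_2(\rho,u)=u-\int_0^\rho\frac{\sqrt{p'(s)}}{s}\,ds,$$ and assume $\Sigma_2(\rho_-,u_-)=\Sigma_2(\rho_+,u_+)$ and $w_-:=\lambda_2(\rho_-,u_-)<w_+:=\lambda_2(\rho_+,u_+)$. *Smoothed 2-rarefaction wave.* Fix $q\ge 2$ and $\eta>0$, let $K_q\int_0^\infty(1+y^2)^{-q}dy=1$ and $$w_0(x)=\frac{w_++w_-}2+\frac{w_+-w_-}2K_q\int_0^{\eta x}(1+y^2)^{-q}dy .$$ Let $w(t,x)=w_0(x_0(t,x))$ with $x=x_0(t,x)+w_0(x_0(t,x))\,t$ (the solution of $w_t+ww_x=0$, $w(0,\cdot)=w_0$). The wave $(\bar\rho,\bar u)(t,x)$, $\bar\rho>0$, is defined for $t\ge 0$ by $$\lambda_2(\bar\rho,\bar u)(t,x)=w(1+t,x),\qquad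 \Sigma_2(\bar\rho,\bar u)(t,x)=\Sigma_2(\rho_-,u_-).$$ *Weak solutions.* Consider $$\rho_t+(\rho u)_x=0,\qquad (\rho u)_t+(\rho u^2+p(\rho))_x=(\rho^\alpha u_x)_x,\qquad (\rho,\rho u)(0,\cdot)=(\rho_0,m_0),$$ for $x\in\mathbb R$, $t>0$. For $D=(\rho^{\alpha-1/2})_x$ (weak derivative) put $$\langle\rho^\alpha(u-\bar u)_x,\varphi\rangle=-\int_0^\infty\!\!\int_{\mathbb R}\rho^{\alpha-\frac12}\sqrt\rho(u-\bar u)\varphi_x\,dx\,dt-\frac{2\alpha}{2\alpha-1}\int_0^\infty\!\!\int_{\mathbb R}D\sqrt\rho(u-\bar u)\varphi\,dx\,dt .$$ The pair $(\rho,u)$ is a (global) weak solution towards $(\bar\rho,\bar u)$ if: 1. $\rho\ge 0$ a.e.; $\rho\in L^\infty(0,T;L^\infty(\mathbb R))$ and $D,\ \sqrt\rho(u-\bar u)\in L^\infty(0,T;L^2(\mathbb R))$ for every $T>0$; $\rho(t,\cdot)\in L^1_{loc}(\mathbb R)$ for all $t\ge0$, and $t\mapsto\int\rho(t,x)\varphi(x)\,dx$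 is continuous on $[0,\infty)$ for every compactly supported $\varphi\in W^{1,\infty}(\mathbb R)$; $\rho(0,\cdot)=\rho_0$ a.e.; $m_0\in L^1_{loc}(\mathbb R)$. 2. For all $t_2\ge t_1\ge 0$ and all $\zeta\in C^1_0(\mathbb R\times[t_1,t_2])$, $$\int_{\mathbb R}(\rho-\bar\rho)\zeta\,dx\Big|_{t_1}^{t_2}=\int_{t_1}^{t_2}\!\!\int_{\mathbb R}\big[(\rho-\bar\rho)\zeta_t+(\rho u-\bar\rho\bar u)\zeta_x\big]dx\,dt .$$ 3. For all $\psi\in C_0^\infty(\mathbb R\times[0,\infty))$, with $\bar\rho_0=\bar\rho(0,\cdot)$, $\bar u_0=\bar u(0,\cdot)$, $$\int_{\mathbb R}(m_0-\bar\rho_0\bar u_0)\psi(0,\cdot)dx+\int_0^\infty\!\!\int_{\mathbb R}\Big(\big\{\sqrt\rho[\sqrt\rho(u-\bar u)]+(\rho-\bar\rho)\bar u\big\}\psi_t+\big\{[\sqrt\rho(u-\bar u)]^2+2\sqrt\rho[\sqrt\rho(u-\bar u)]\bar u+(\rho-\bar\rho)\bar u^2+\rho^\gamma-\bar\rho^\gamma\big\}\psi_x\Big)dx\,dt$$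 $$-\langle\rho^\alpha(u-\bar u)_x,\psi_x\rangle-\int_0^\infty\!\!\int_{\mathbb R}\rho^\alpha\bar u_x\psi_x\,dx\,dt=0 .$$ *Claim.* Let $(\rho,u)$ be any such weak solution with $\rho\in C(\mathbb R\times(0,\infty))$, and suppose there is a constant $C$, independent of $T$, such that $0\le\rho\le C$ on $\mathbb R\times(0,\infty)$ and, for every $T>0$, $$\operatorname*{ess\,sup}_{t\in[0,T]}\int_{\mathbb R}\Big(|\sqrt\rho(u-\bar u)|^2+[(\rho^{\alpha-\frac12})_x]^2+\tfrac1{\gamma-1}\big[\rho^\gamma-\bar\rho^\gamma-\gamma\bar\rho^{\gamma-1}(\rho-\bar\rho)\big]\Big)dx+\int_0^T\!\!\int_{\mathbb R}\Big(\big[(\rho^{\frac{\gamma+\alpha-1}2}-\bar\rho^{\frac{\gamma+\alpha-1}2})_x\big]^2+\Lambda^2\Big)dx\,dt\le C,$$ where the derivatives are weak derivatives and $\Lambda\in L^2(\mathbb R\times(0,T))$ for every $T$ satisfies $\int_0^\infty\!\int_{\mathbb R}\Lambda\varphi\,dx\,dt=\langle\rho^\alpha(u-\bar u)_x,\varphi\rangle$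 for all $\varphi\in C_0^\infty(\mathbb R\times(0,\infty))$. Then $$\lim_{t\to\infty}\ \sup_{x\in\mathbb R}|\rho(t,x)-\bar\rho(t,x)|=0 .$$ -/

import Mathlib

open MeasureTheory Set Filter Topology
open scoped ENNReal NNReal ContDiff

namespace NSRarefaction

noncomputable section

/-! Functions of time and space are curried: `f t x`. -/

/-! ### Euler system: pressure, second characteristic speed, second Riemann invariant -/

/-- The pressure law `p(ρ) = ρ ^ γ`. -/
def pressure (γ r : ℝ) : ℝ := r ^ γ

/-- The derivative `p'(ρ) = γ ρ ^ (γ - 1)` of the pressure. -/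
def pressure' (γ r : ℝ) : ℝ := γ * r ^ (γ - 1)

theorem hasDerivAt_pressure (γ : ℝ) {r : ℝ} (hr : 0 < r) :
    HasDerivAt (pressure γ) (pressure' γ r) r :=
  Real.hasDerivAt_rpow_const (Or.inl hr.ne')

/-- `λ₂(ρ, u) = u + √p'(ρ)`. -/
def lambda2 (γ r v : ℝ) : ℝ := v + √(pressure' γ r)

/-- `Σ₂(ρ, u) = u - ∫^ρ √p'(s) / s ds`. The sign is the one for which `Σ₂` is constant along the
direction `(1, √p'(ρ) / ρ)` of the second characteristic field. -/
def sigma2 (γ r v : ℝ) : ℝ := v - ∫ s in (0 : ℝ)..r, √(pressure' γ s) / s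

/-! ### The smooth Burgers wave -/

/-- The normalising constant `K_q`, with `K_q ∫₀^∞ (1 + y²)^(-q) dy = 1`. -/
def burgersK (q : ℝ) : ℝ := (∫ y in Ioi (0 : ℝ), (1 + y ^ 2) ^ (-q))⁻¹

/-- The Burgers initial datum. -/
def burgersInit (q η wm wp x : ℝ) : ℝ :=
  (wp + wm) / 2 + (wp - wm) / 2 * (burgersK q * ∫ y in (0 : ℝ)..(η * x), (1 + y ^ 2) ^ (-q))

theorem integrable_burgersKernel {q : ℝ} (hq : 2 ≤ q) :
    Integrable (fun y : ℝ => (1 + y ^ 2) ^ (-q)) := by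
  have h := integrable_rpow_neg_one_add_norm_sq (E := ℝ) (μ := volume) (r := 2 * q)
    (by simp; linarith)
  refine h.congr (Eventually.of_forall fun y => ?_)
  simp only [Real.norm_eq_abs, sq_abs]
  congr 1
  ring

theorem continuous_burgersKernel (q : ℝ) : Continuous (fun y : ℝ => (1 + y ^ 2) ^ (-q)) := by
  refine Continuous.rpow_const (by fun_prop) fun y => Or.inl ?_
  positivity

theorem burgersK_pos {q : ℝ} (hq : 2 ≤ q) : 0 < burgersK q := by
  refine inv_pos.2 ?_
  rw [setIntegral_pos_iff_support_of_nonneg_ae]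
  · have : Function.support (fun y : ℝ => (1 + y ^ 2) ^ (-q)) = univ := by
      ext y
      simp only [Function.mem_support, mem_univ, iff_true]
      exact (Real.rpow_pos_of_pos (by positivity) _).ne'
    rw [this]
    simp
  · exact Eventually.of_forall fun y => Real.rpow_nonneg (by positivity) _
  · exact (integrable_burgersKernel hq).integrableOn

theorem burgersPrimitive_le {q : ℝ} (hq : 2 ≤ q) (z : ℝ) :
    |burgersK q * ∫ y in (0 : ℝ)..z, (1 + y ^ 2) ^ (-q)| ≤ 1 := by
  have hpos : ∀ z : ℝ, 0 ≤ z →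
      |burgersK q * ∫ y in (0 : ℝ)..z, (1 + y ^ 2) ^ (-q)| ≤ 1 := by
    intro z hz
    have h0 : 0 ≤ ∫ y in (0 : ℝ)..z, (1 + y ^ 2) ^ (-q) :=
      intervalIntegral.integral_nonneg hz fun y _ => Real.rpow_nonneg (by positivity) _
    have h1 : ∫ y in (0 : ℝ)..z, (1 + y ^ 2) ^ (-q) ≤ (burgersK q)⁻¹ := by
      rw [burgersK, inv_inv, intervalIntegral.integral_of_le hz]
      refine setIntegral_mono_set (integrable_burgersKernel hq).integrableOn
        (Eventually.of_forall fun y => Real.rpow_nonneg (by positivity) _) ?_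
      exact Ioc_subset_Ioi_self.eventuallyLE
    rw [abs_of_nonneg (mul_nonneg (burgersK_pos hq).le h0)]
    calc _ ≤ burgersK q * (burgersK q)⁻¹ := mul_le_mul_of_nonneg_left h1 (burgersK_pos hq).le
      _ = 1 := mul_inv_cancel₀ (burgersK_pos hq).ne'
  rcases le_total 0 z with hz | hz
  · exact hpos z hz
  · have h := hpos (-z) (by linarith)
    have e := intervalIntegral.integral_comp_neg (a := 0) (b := z)
      (fun y : ℝ => (1 + y ^ 2) ^ (-q))
    simp only [neg_sq, neg_zero] at e
    rw [e, intervalIntegral.integral_symm, mul_neg, abs_neg]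
    exact h

theorem burgersInit_mem {q η wm wp : ℝ} (hq : 2 ≤ q) (hw : wm ≤ wp) (x : ℝ) :
    burgersInit q η wm wp x ∈ Icc wm wp := by
  have h := abs_le.1 (burgersPrimitive_le hq (η * x))
  unfold burgersInit
  constructor <;> nlinarith [h.1, h.2]

theorem continuous_burgersInit (q η wm wp : ℝ) : Continuous (burgersInit q η wm wp) := by
  unfold burgersInit
  have h := intervalIntegral.continuous_primitive
    (fun a b => (continuous_burgersKernel q).intervalIntegrable (μ := volume) a b) 0
  have h' : Continuous fun x : ℝ => ∫ y in (0 : ℝ)..(η * x), (1 + y ^ 2) ^ (-q) :=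
    h.comp (continuous_const.mul continuous_id)
  fun_prop

theorem monotone_burgersInit {q η wm wp : ℝ} (hq : 2 ≤ q) (hη : 0 < η) (hw : wm ≤ wp) :
    Monotone (burgersInit q η wm wp) := by
  intro x y hxy
  have hi := fun a b => (continuous_burgersKernel q).intervalIntegrable (μ := volume) a b
  have h : ∫ s in (0 : ℝ)..(η * x), (1 + s ^ 2) ^ (-q) ≤
      ∫ s in (0 : ℝ)..(η * y), (1 + s ^ 2) ^ (-q) := by
    rw [← intervalIntegral.integral_add_adjacent_intervals (hi 0 (η * x)) (hi (η * x) (η * y))]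
    have := intervalIntegral.integral_nonneg (μ := volume)
      (mul_le_mul_of_nonneg_left hxy hη.le)
      fun s _ => Real.rpow_nonneg (by positivity : 0 ≤ 1 + s ^ 2) (-q)
    linarith
  have := mul_le_mul_of_nonneg_left (mul_le_mul_of_nonneg_left h (burgersK_pos hq).le)
    (by linarith : 0 ≤ (wp - wm) / 2)
  unfold burgersInit
  linarith

/-- The foot `x₀(t, x)` of the characteristic through `(t, x)`, that is, the solution of
`x = x₀ + w₀(x₀) t`; see `burgersFoot_iff`. -/
def burgersFoot (q η wm wp t x : ℝ) : ℝ :=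
  Function.invFun (fun y : ℝ => y + burgersInit q η wm wp y * t) x

/-- The solution `w(t, x) = w₀(x₀(t, x))` of `w_t + w w_x = 0`, `w(0, ·) = w₀`. -/
def burgersWave (q η wm wp t x : ℝ) : ℝ :=
  burgersInit q η wm wp (burgersFoot q η wm wp t x)

/-- For `t ≥ 0` the foot is the unique solution of `x₀ + w₀(x₀) t = x`. -/
theorem burgersFoot_iff {q η wm wp t : ℝ} (hq : 2 ≤ q) (hη : 0 < η) (hw : wm ≤ wp) (ht : 0 ≤ t)
    (x y : ℝ) : burgersFoot q η wm wp t x = y ↔ x = y + burgersInit q η wm wp y * t := by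
  set f : ℝ → ℝ := fun y => y + burgersInit q η wm wp y * t with hf
  have hmono : StrictMono f := by
    intro a b hab
    have := mul_le_mul_of_nonneg_right (monotone_burgersInit hq hη hw hab.le) ht
    simp only [hf]
    linarith
  have hcont : Continuous f := by
    have := continuous_burgersInit q η wm wp
    fun_prop
  have hsurj : Function.Surjective f := by
    refine hcont.surjective ?_ ?_
    · refine tendsto_atTop_mono (g := f) (f := fun y => y + wm * t) (fun y => ?_)
        (tendsto_atTop_add_const_right _ _ tendsto_id)
      have := mul_le_mul_of_nonneg_right (burgersInit_mem (η := η) hq hw y).1 ht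
      simp only [hf]
      linarith
    · refine tendsto_atBot_mono (g := f) (f := fun y => y + wp * t) (fun y => ?_)
        (tendsto_atBot_add_const_right _ _ tendsto_id)
      have := mul_le_mul_of_nonneg_right (burgersInit_mem (η := η) hq hw y).2 ht
      simp only [hf]
      linarith
  have key : f (burgersFoot q η wm wp t x) = x := Function.rightInverse_invFun hsurj x
  constructor
  · rintro rfl
    exact key.symm
  · intro h
    exact hmono.injective (key.trans h)

theorem burgersWave_mem {q η wm wp : ℝ} (hq : 2 ≤ q) (hw : wm ≤ wp) (t x : ℝ) :
    burgersWave q η wm wp t x ∈ Icc wm wp :=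
  burgersInit_mem hq hw _

/-! ### The smooth approximate 2-rarefaction wave -/

/-- The density component of the solution `(r, v)`, `r > 0`, of `λ₂(r, v) = w`, `Σ₂(r, v) = S`;
see `lambda2_sigma2_iff`. -/
def invertDensity (γ w S : ℝ) : ℝ :=
  ((γ - 1) * (w - S) / (√γ * (γ + 1))) ^ (2 / (γ - 1))

/-- The velocity component of the solution `(r, v)`, `r > 0`, of `λ₂(r, v) = w`, `Σ₂(r, v) = S`;
see `lambda2_sigma2_iff`. -/
def invertVelocity (γ w S : ℝ) : ℝ := S + 2 / (γ + 1) * (w - S)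

theorem sqrt_pressure' {γ r : ℝ} (hγ : 1 < γ) (hr : 0 ≤ r) :
    √(pressure' γ r) = √γ * r ^ ((γ - 1) / 2) := by
  rw [pressure', Real.sqrt_mul (by linarith), Real.sqrt_eq_rpow (r ^ (γ - 1)), ← Real.rpow_mul hr]
  congr 2
  ring

theorem sigma2_eq {γ r : ℝ} (hγ : 1 < γ) (hr : 0 < r) (v : ℝ) :
    sigma2 γ r v = v - √γ * (2 / (γ - 1)) * r ^ ((γ - 1) / 2) := by
  have hg : (γ - 1) ≠ 0 := by linarith
  have h : ∫ s in (0 : ℝ)..r, √(pressure' γ s) / s =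
      ∫ s in (0 : ℝ)..r, √γ * s ^ ((γ - 1) / 2 - 1) := by
    refine intervalIntegral.integral_congr_ae (Eventually.of_forall fun s hs => ?_)
    rw [uIoc_of_le hr.le] at hs
    rw [sqrt_pressure' hγ hs.1.le, Real.rpow_sub_one hs.1.ne']
    ring
  rw [sigma2, h, intervalIntegral.integral_const_mul, integral_rpow (Or.inl (by linarith)),
    Real.zero_rpow (by rw [sub_add_cancel]; positivity), sub_add_cancel]
  field_simp
  ring

theorem invertDensity_pos {γ w S : ℝ} (hγ : 1 < γ) (hS : S < w) : 0 < invertDensity γ w S := by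
  have h1 : 0 < γ - 1 := by linarith
  have h2 : 0 < w - S := by linarith
  have h3 : 0 < √γ := Real.sqrt_pos.2 (by linarith)
  exact Real.rpow_pos_of_pos (by positivity) _

/-- The inversion formulas give the unique state with prescribed `λ₂` and `Σ₂`. -/
theorem lambda2_sigma2_iff {γ w S r v : ℝ} (hγ : 1 < γ) (hS : S < w) (hr : 0 < r) :
    (lambda2 γ r v = w ∧ sigma2 γ r v = S) ↔
      (r = invertDensity γ w S ∧ v = invertVelocity γ w S) := by
  have h1 : 0 < γ - 1 := by linarith
  have h2 : 0 < w - S := by linarith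
  have h3 : 0 < √γ := Real.sqrt_pos.2 (by linarith)
  have h4 : 0 < γ + 1 := by linarith
  set c := (γ - 1) * (w - S) / (√γ * (γ + 1)) with hc
  have hc0 : 0 < c := by positivity
  have hden : r = invertDensity γ w S ↔ r ^ ((γ - 1) / 2) = c := by
    rw [invertDensity, ← hc]
    constructor
    · rintro rfl
      rw [← Real.rpow_mul hc0.le]
      have : 2 / (γ - 1) * ((γ - 1) / 2) = 1 := by field_simp
      rw [this, Real.rpow_one]
    · intro h
      rw [← h, ← Real.rpow_mul hr.le]
      have : (γ - 1) / 2 * (2 / (γ - 1)) = 1 := by field_simp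
      rw [this, Real.rpow_one]
  rw [hden, lambda2, sqrt_pressure' hγ hr.le, sigma2_eq hγ hr, invertVelocity]
  set P := r ^ ((γ - 1) / 2) with hP
  have hcc : √γ * c = (γ - 1) * (w - S) / (γ + 1) := by
    rw [hc]
    field_simp
  constructor
  · rintro ⟨ha, hb⟩
    have hPc : √γ * P = √γ * c := by
      rw [hcc, ← ha, ← hb]
      field_simp
      ring
    refine ⟨mul_left_cancel₀ h3.ne' hPc, ?_⟩
    have : v = w - √γ * c := by rw [← hPc]; linarith
    rw [this, hcc]
    field_simp
    ring
  · rintro ⟨ha, rfl⟩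
    rw [ha]
    constructor
    · rw [hcc]
      field_simp
      ring
    · rw [mul_right_comm, hcc]
      field_simp
      ring

/-- The density `ρ̄(t, x)` of the rarefaction wave with end states `(rm, um)` and `(rp, up)`. -/
def rarefactionDensity (γ q η rm um rp up t x : ℝ) : ℝ :=
  invertDensity γ (burgersWave q η (lambda2 γ rm um) (lambda2 γ rp up) (1 + t) x) (sigma2 γ rm um)

/-- The velocity `ū(t, x)` of the rarefaction wave with end states `(rm, um)` and `(rp, up)`. -/
def rarefactionVelocity (γ q η rm um rp up t x : ℝ) : ℝ :=
  invertVelocity γ (burgersWave q η (lambda2 γ rm um) (lambda2 γ rp up) (1 + t) x) (sigma2 γ rm um)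

/-- `(ρ̄, ū)` is characterised by `ρ̄ > 0`, `λ₂(ρ̄, ū)(t, x) = w(1 + t, x)` and
`Σ₂(ρ̄, ū) = Σ₂(ρ₋, u₋)`. -/
theorem rarefaction_spec {γ q η rm um rp up : ℝ} (hγ : 1 < γ) (hq : 2 ≤ q) (hrm : 0 < rm)
    (hlambda : lambda2 γ rm um < lambda2 γ rp up) (t x : ℝ) :
    0 < rarefactionDensity γ q η rm um rp up t x ∧
    ∀ r > 0, ∀ v,
      (lambda2 γ r v = burgersWave q η (lambda2 γ rm um) (lambda2 γ rp up) (1 + t) x ∧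
        sigma2 γ r v = sigma2 γ rm um) ↔
      (r = rarefactionDensity γ q η rm um rp up t x ∧
        v = rarefactionVelocity γ q η rm um rp up t x) := by
  have h0 : sigma2 γ rm um < lambda2 γ rm um := by
    rw [sigma2_eq hγ hrm, lambda2, sqrt_pressure' hγ hrm.le]
    have h1 : 0 < γ - 1 := by linarith
    have h3 : 0 < √γ := Real.sqrt_pos.2 (by linarith)
    have : 0 < √γ * (2 / (γ - 1)) * rm ^ ((γ - 1) / 2) := by positivity
    have : 0 < √γ * rm ^ ((γ - 1) / 2) := by positivity
    linarith
  have hS := h0.trans_le (burgersWave_mem (η := η) hq hlambda.le (1 + t) x).1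
  exact ⟨invertDensity_pos hγ hS, fun r hr v => lambda2_sigma2_iff hγ hS hr⟩

/-! ### Weak solutions -/

/-- `g` is the weak derivative of `f` on the line. -/
def HasWeakDeriv (f g : ℝ → ℝ) : Prop :=
  LocallyIntegrable f ∧ LocallyIntegrable g ∧
    ∀ φ : ℝ → ℝ, ContDiff ℝ ∞ φ → HasCompactSupport φ →
      ∫ x, f x * deriv φ x = -∫ x, g x * φ x

/-- `g` is the weak derivative `f_x` of `f` in space, at almost every time `t > 0`. -/
def HasWeakSpaceDeriv (f g : ℝ → ℝ → ℝ) : Prop :=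
  AEStronglyMeasurable (Function.uncurry g) (volume.restrict (Ioi (0 : ℝ) ×ˢ (univ : Set ℝ))) ∧
    ∀ᵐ t ∂volume.restrict (Ioi (0 : ℝ)), HasWeakDeriv (f t) (g t)

/-- `f ∈ L^∞(0, T; L²(ℝ))`. -/
def MemLinftyL2 (T : ℝ) (f : ℝ → ℝ → ℝ) : Prop :=
  AEStronglyMeasurable (Function.uncurry f) (volume.restrict (Ioo (0 : ℝ) T ×ˢ (univ : Set ℝ))) ∧
    essSup (fun t => eLpNorm (f t) 2 volume) (volume.restrict (Ioo (0 : ℝ) T)) < ⊤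

/-- The pairing `⟨ρ^α (u - ū)_x, φ⟩`, written without differentiating `u - ū`; here `D` stands for
`(ρ^(α-1/2))_x`. -/
def diffusionPairing (α : ℝ) (rho u ubar D φ : ℝ → ℝ → ℝ) : ℝ :=
  -(∫ t in Ioi (0 : ℝ), ∫ x,
      rho t x ^ (α - 1 / 2) * (√(rho t x) * (u t x - ubar t x)) * deriv (φ t) x)
  - 2 * α / (2 * α - 1) *
      ∫ t in Ioi (0 : ℝ), ∫ x, D t x * (√(rho t x) * (u t x - ubar t x)) * φ t x

/-- `(ρ, u)` is a (global) weak solution, towards the wave `(ρ̄, ū)`, of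
`ρ_t + (ρu)_x = 0`, `(ρu)_t + (ρu² + ρ^γ)_x = (ρ^α u_x)_x`, `(ρ, ρu)(0, ·) = (ρ₀, m₀)`. -/
structure IsWeakSolution (γ α : ℝ) (rhobar ubar : ℝ → ℝ → ℝ) (rho0 m0 : ℝ → ℝ)
    (rho u : ℝ → ℝ → ℝ) : Prop where
  /-- `ρ ≥ 0` almost everywhere. -/
  nonneg : ∀ᵐ z : ℝ × ℝ ∂volume.restrict (Ioi (0 : ℝ) ×ˢ (univ : Set ℝ)), 0 ≤ rho z.1 z.2
  /-- `ρ ∈ L^∞(0, T; L^∞(ℝ))` for every `T`. -/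
  bounded : ∀ T > 0,
    MemLp (Function.uncurry rho) ∞ (volume.restrict (Ioo (0 : ℝ) T ×ˢ (univ : Set ℝ)))
  locallyIntegrable : ∀ t ≥ 0, LocallyIntegrable (rho t)
  /-- `ρ` is continuous in time on `[0, ∞)` when tested against functions of `W^{1,∞}(ℝ)` (Lipschitz
  functions) of compact support. -/
  continuous_time : ∀ φ : ℝ → ℝ, (∃ K : ℝ≥0, LipschitzWith K φ) → HasCompactSupport φ →
    ContinuousOn (fun t => ∫ x, rho t x * φ x) (Ici 0)
  /-- `√ρ (u - ū) ∈ L^∞(0, T; L²(ℝ))` for every `T`. -/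
  velocity : ∀ T > 0, MemLinftyL2 T (fun t x => √(rho t x) * (u t x - ubar t x))
  initial_density : rho 0 =ᵐ[volume] rho0
  initial_momentum : LocallyIntegrable m0
  /-- The mass equation. -/
  mass : ∀ t₁ t₂ : ℝ, 0 ≤ t₁ → t₁ ≤ t₂ → ∀ ζ : ℝ → ℝ → ℝ,
    ContDiff ℝ 1 (Function.uncurry ζ) → HasCompactSupport (Function.uncurry ζ) →
      (∫ x, (rho t₂ x - rhobar t₂ x) * ζ t₂ x) - (∫ x, (rho t₁ x - rhobar t₁ x) * ζ t₁ x) =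
        ∫ t in t₁..t₂, ∫ x,
          ((rho t x - rhobar t x) * deriv (fun s => ζ s x) t
            + (rho t x * u t x - rhobar t x * ubar t x) * deriv (ζ t) x)
  /-- `(ρ^(α-1/2))_x` exists, belongs to `L^∞(0, T; L²(ℝ))` for every `T`, and the momentum equation
  holds. -/
  momentum : ∃ D : ℝ → ℝ → ℝ, HasWeakSpaceDeriv (fun t x => rho t x ^ (α - 1 / 2)) D ∧
    (∀ T > 0, MemLinftyL2 T D) ∧
    ∀ ψ : ℝ → ℝ → ℝ,
      ContDiff ℝ ∞ (Function.uncurry ψ) → HasCompactSupport (Function.uncurry ψ) →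
        (∫ x, (m0 x - rhobar 0 x * ubar 0 x) * ψ 0 x)
        + (∫ t in Ioi (0 : ℝ), ∫ x,
            ((√(rho t x) * (√(rho t x) * (u t x - ubar t x))
                + (rho t x - rhobar t x) * ubar t x) * deriv (fun s => ψ s x) t
              + ((√(rho t x) * (u t x - ubar t x)) ^ 2
                + 2 * √(rho t x) * (√(rho t x) * (u t x - ubar t x)) * ubar t x
                + (rho t x - rhobar t x) * ubar t x ^ 2
                + (pressure γ (rho t x) - pressure γ (rhobar t x))) * deriv (ψ t) x))
        - diffusionPairing α rho u ubar D (fun t => deriv (ψ t))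
        - (∫ t in Ioi (0 : ℝ), ∫ x, rho t x ^ α * deriv (ubar t) x * deriv (ψ t) x) = 0

/-- The uniform pointwise, energy and entropy bounds: with one constant `C` for all `T > 0`,
`0 ≤ ρ ≤ C` and
`sup_{[0,T]} ∫ |√ρ(u-ū)|² + (ρ^(α-1/2))_x² + (ρ^γ - ρ̄^γ - γ ρ̄^(γ-1) (ρ - ρ̄))/(γ-1) dx
  + ∫₀ᵀ∫ ((ρ^b - ρ̄^b)_x)² + Λ² dx dt ≤ C`, where `b = (γ+α-1)/2`. Here `D = (ρ^(α-1/2))_x`,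
`F = (ρ^b - ρ̄^b)_x` and `Λ = ρ^α (u - ū)_x` in the sense of the diffusion pairing. -/
def HasUniformBounds (γ α : ℝ) (rhobar ubar rho u : ℝ → ℝ → ℝ) : Prop :=
  ∃ C : ℝ≥0, (∀ t > 0, ∀ x, 0 ≤ rho t x ∧ rho t x ≤ C) ∧
    ∃ D F Λ : ℝ → ℝ → ℝ,
      HasWeakSpaceDeriv (fun t x => rho t x ^ (α - 1 / 2)) D ∧
      HasWeakSpaceDeriv
        (fun t x => rho t x ^ ((γ + α - 1) / 2) - rhobar t x ^ ((γ + α - 1) / 2)) F ∧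
      (∀ T > 0,
        MemLp (Function.uncurry Λ) 2 (volume.restrict (Ioo (0 : ℝ) T ×ˢ (univ : Set ℝ)))) ∧
      (∀ φ : ℝ → ℝ → ℝ,
        ContDiff ℝ ∞ (Function.uncurry φ) → HasCompactSupport (Function.uncurry φ) →
        tsupport (Function.uncurry φ) ⊆ Ioi (0 : ℝ) ×ˢ (univ : Set ℝ) →
          ∫ t in Ioi (0 : ℝ), ∫ x, Λ t x * φ t x = diffusionPairing α rho u ubar D φ) ∧
      ∀ T > 0,
        essSup (fun t => ∫⁻ x, ENNReal.ofReal
            ((√(rho t x) * (u t x - ubar t x)) ^ 2 + D t x ^ 2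
              + 1 / (γ - 1) * (rho t x ^ γ - rhobar t x ^ γ
                  - γ * rhobar t x ^ (γ - 1) * (rho t x - rhobar t x))))
          (volume.restrict (Ioo (0 : ℝ) T))
        + ∫⁻ t in Ioo (0 : ℝ) T, ∫⁻ x, ENNReal.ofReal (F t x ^ 2 + Λ t x ^ 2) ≤ (C : ℝ≥0∞)

end

end NSRarefaction

namespace NSRarefaction

/-! ### Smooth steps and mollifiers -/

/-- A smooth monotone step from `0` to `1`, which rises on `[a, a + δ]`. -/
noncomputable def smoothStep (δ a x : ℝ) : ℝ := Real.smoothTransition ((x - a) / δ)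

/-- The derivative of `smoothStep`, a mollifier supported in `[a, a + δ]`. -/
noncomputable def stepKernel (δ a : ℝ) : ℝ → ℝ := deriv (smoothStep δ a)

theorem contDiff_smoothStep (δ a : ℝ) : ContDiff ℝ ∞ (smoothStep δ a) := by
  have h : ContDiff ℝ ∞ Real.smoothTransition := Real.smoothTransition.contDiff
  exact h.comp ((contDiff_id.sub contDiff_const).div_const δ)

theorem differentiable_smoothStep (δ a : ℝ) : Differentiable ℝ (smoothStep δ a) :=
  (contDiff_smoothStep δ a).differentiable (by simp)

theorem smoothStep_nonneg (δ a x : ℝ) : 0 ≤ smoothStep δ a x := Real.smoothTransition.nonneg _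

theorem smoothStep_le_one (δ a x : ℝ) : smoothStep δ a x ≤ 1 := Real.smoothTransition.le_one _

theorem smoothStep_of_le {δ a x : ℝ} (hδ : 0 < δ) (hx : x ≤ a) : smoothStep δ a x = 0 :=
  Real.smoothTransition.zero_of_nonpos (div_nonpos_of_nonpos_of_nonneg (by linarith) hδ.le)

theorem smoothStep_of_ge {δ a x : ℝ} (hδ : 0 < δ) (hx : a + δ ≤ x) : smoothStep δ a x = 1 :=
  Real.smoothTransition.one_of_one_le ((one_le_div hδ).2 (by linarith))

theorem contDiff_stepKernel (δ a : ℝ) : ContDiff ℝ ∞ (stepKernel δ a) :=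
  (contDiff_infty_iff_deriv.1 (contDiff_smoothStep δ a)).2

theorem stepKernel_nonneg {δ : ℝ} (hδ : 0 < δ) (a x : ℝ) : 0 ≤ stepKernel δ a x := by
  refine Monotone.deriv_nonneg fun y z hyz => Real.smoothTransition.monotone ?_
  exact div_le_div_of_nonneg_right (by linarith) hδ.le

theorem stepKernel_eq_zero {δ a x : ℝ} (hδ : 0 < δ) (hx : x ∉ Icc a (a + δ)) :
    stepKernel δ a x = 0 := by
  have h : x < a ∨ a + δ < x := by
    by_contra! h
    exact hx h
  rcases h with h | h
  · have : smoothStep δ a =ᶠ[𝓝 x] fun _ => 0 := by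
      filter_upwards [Iio_mem_nhds h] with y hy using smoothStep_of_le hδ hy.le
    rw [stepKernel, this.deriv_eq, deriv_const]
  · have : smoothStep δ a =ᶠ[𝓝 x] fun _ => 1 := by
      filter_upwards [Ioi_mem_nhds h] with y hy using smoothStep_of_ge hδ hy.le
    rw [stepKernel, this.deriv_eq, deriv_const]

theorem hasCompactSupport_stepKernel {δ : ℝ} (hδ : 0 < δ) (a : ℝ) :
    HasCompactSupport (stepKernel δ a) :=
  HasCompactSupport.intro isCompact_Icc fun _ hx => stepKernel_eq_zero hδ hx

theorem integral_stepKernel {δ : ℝ} (hδ : 0 < δ) (a : ℝ) : ∫ x, stepKernel δ a x = 1 := by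
  rw [← setIntegral_eq_integral_of_forall_compl_eq_zero (s := Icc a (a + δ))
    fun x hx => stepKernel_eq_zero hδ hx, integral_Icc_eq_integral_Ioc,
    ← intervalIntegral.integral_of_le (by linarith),
    intervalIntegral.integral_deriv_eq_sub' (f' := stepKernel δ a) (smoothStep δ a) rfl
      (fun x _ => differentiable_smoothStep δ a x)
      (contDiff_stepKernel δ a).continuous.continuousOn,
    smoothStep_of_le hδ le_rfl, smoothStep_of_ge hδ le_rfl, sub_zero]

theorem stepKernel_translate (δ a x : ℝ) : stepKernel δ a x = stepKernel δ 0 (x - a) := by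
  have h : smoothStep δ a = fun x => smoothStep δ 0 (x - a) := by
    funext y
    simp [smoothStep]
  rw [stepKernel, h, deriv_comp_sub_const, stepKernel]

theorem exists_bound_deriv_stepKernel {δ : ℝ} (hδ : 0 < δ) :
    ∃ B, ∀ a x, |deriv (stepKernel δ a) x| ≤ B := by
  obtain ⟨B, hB⟩ := (hasCompactSupport_stepKernel hδ 0).deriv.exists_bound_of_continuous
    ((contDiff_stepKernel δ 0).continuous_deriv (by simp))
  refine ⟨B, fun a x => ?_⟩
  have h : stepKernel δ a = fun x => stepKernel δ 0 (x - a) := funext (stepKernel_translate δ a)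
  rw [h, deriv_comp_sub_const]
  exact hB _

theorem deriv_stepKernel_eq_zero {δ a x : ℝ} (hδ : 0 < δ) (hx : x ∉ Icc a (a + δ)) :
    deriv (stepKernel δ a) x = 0 := by
  have : stepKernel δ a =ᶠ[𝓝 x] fun _ => 0 := by
    filter_upwards [isClosed_Icc.isOpen_compl.mem_nhds hx] with y hy
    exact stepKernel_eq_zero hδ hy
  rw [this.deriv_eq, deriv_const]

theorem integrable_mul_stepKernel {f : ℝ → ℝ} (hf : Continuous f) {δ : ℝ} (hδ : 0 < δ) (a : ℝ) :
    Integrable fun x => f x * stepKernel δ a x :=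
  (hf.mul (contDiff_stepKernel δ a).continuous).integrable_of_hasCompactSupport
    ((hasCompactSupport_stepKernel hδ a).mul_left)

/-- Averaging against a mollifier moves a function by at most its oscillation. -/
theorem abs_integral_mul_stepKernel_sub_le {f : ℝ → ℝ} (hf : Continuous f) {δ ε a : ℝ}
    (hδ : 0 < δ) (h : ∀ x ∈ Icc a (a + δ), |f x - f a| ≤ ε) :
    |(∫ x, f x * stepKernel δ a x) - f a| ≤ ε := by
  have hk : ∀ c : ℝ, Integrable fun x => c * stepKernel δ a x := fun c =>
    integrable_mul_stepKernel continuous_const hδ a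
  have hc : ∀ c : ℝ, ∫ x, c * stepKernel δ a x = c := fun c => by
    rw [integral_const_mul, integral_stepKernel hδ, mul_one]
  have e : (∫ x, f x * stepKernel δ a x) - f a = ∫ x, (f x - f a) * stepKernel δ a x := by
    simp_rw [sub_mul]
    rw [integral_sub (integrable_mul_stepKernel hf hδ a) (hk _), hc]
  rw [e]
  rw [← Real.norm_eq_abs]
  refine (norm_integral_le_of_norm_le (hk ε) (Eventually.of_forall fun x => ?_)).trans_eq (hc ε)
  by_cases hx : x ∈ Icc a (a + δ)
  · rw [norm_mul, Real.norm_eq_abs, Real.norm_eq_abs, abs_of_nonneg (stepKernel_nonneg hδ a x)]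
    exact mul_le_mul_of_nonneg_right (h x hx) (stepKernel_nonneg hδ a x)
  · simp [stepKernel_eq_zero hδ hx]

/-! ### Modulus of continuity from a square integrable weak derivative -/

theorem abs_integral_mul_le_of_sq {g φ : ℝ → ℝ} {M lam a b : ℝ} (hM : 0 ≤ M) (hlam : 0 < lam)
    (hab : a ≤ b)
    (hg : ∫⁻ x, ENNReal.ofReal (g x ^ 2) ≤ ENNReal.ofReal M) (hφ : ∀ x, |φ x| ≤ 1)
    (hs : ∀ x ∉ Icc a b, φ x = 0) :
    |∫ x, g x * φ x| ≤ lam * M + (b - a) / (4 * lam) := by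
  have hab' : 0 ≤ (b - a) / (4 * lam) := div_nonneg (by linarith) (by linarith)
  have hbound : ∀ x, ‖g x * φ x‖ₑ ≤ ENNReal.ofReal lam * ENNReal.ofReal (g x ^ 2) +
      (Icc a b).indicator (fun _ => ENNReal.ofReal (1 / (4 * lam))) x := by
    intro x
    by_cases hx : x ∈ Icc a b
    · rw [indicator_of_mem hx, ← ENNReal.ofReal_mul hlam.le,
        ← ENNReal.ofReal_add (by positivity) (by positivity), ← ofReal_norm]
      refine ENNReal.ofReal_le_ofReal ?_
      rw [norm_mul, Real.norm_eq_abs, Real.norm_eq_abs]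
      have h1 : |g x| * |φ x| ≤ |g x| := mul_le_of_le_one_right (abs_nonneg _) (hφ x)
      have h2 : lam * g x ^ 2 + 1 / (4 * lam) - |g x| = (2 * lam * |g x| - 1) ^ 2 / (4 * lam) := by
        rw [← sq_abs (g x)]
        field_simp
        ring
      have h3 : 0 ≤ (2 * lam * |g x| - 1) ^ 2 / (4 * lam) := by positivity
      linarith
    · simp [hs x hx]
  have h : ‖∫ x, g x * φ x‖ₑ ≤ ENNReal.ofReal (lam * M + (b - a) / (4 * lam)) := by
    calc ‖∫ x, g x * φ x‖ₑ ≤ ∫⁻ x, ‖g x * φ x‖ₑ := enorm_integral_le_lintegral_enorm _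
      _ ≤ ∫⁻ x, (ENNReal.ofReal lam * ENNReal.ofReal (g x ^ 2) +
          (Icc a b).indicator (fun _ => ENNReal.ofReal (1 / (4 * lam))) x) :=
        lintegral_mono hbound
      _ = ENNReal.ofReal lam * (∫⁻ x, ENNReal.ofReal (g x ^ 2)) +
          ENNReal.ofReal (1 / (4 * lam)) * ENNReal.ofReal (b - a) := by
        rw [lintegral_add_right _ (measurable_const.indicator measurableSet_Icc),
          lintegral_const_mul' _ _ ENNReal.ofReal_ne_top, lintegral_indicator measurableSet_Icc,
          setLIntegral_const, Real.volume_Icc]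
      _ ≤ ENNReal.ofReal lam * ENNReal.ofReal M +
          ENNReal.ofReal (1 / (4 * lam)) * ENNReal.ofReal (b - a) := by gcongr
      _ = ENNReal.ofReal (lam * M + (b - a) / (4 * lam)) := by
        rw [← ENNReal.ofReal_mul hlam.le, ← ENNReal.ofReal_mul (by positivity),
          ← ENNReal.ofReal_add (by positivity) (mul_nonneg (by positivity) (by linarith))]
        congr 2
        ring
  rw [← ofReal_norm] at h
  exact (ENNReal.ofReal_le_ofReal_iff (by positivity)).1 h

/-- If `f` is continuous with weak derivative `g`, and `∫ g² ≤ M`, then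
`|f b - f a| ≤ √(M (b - a))`, here in the form of the weighted arithmetic-geometric inequality. -/
theorem HasWeakDeriv.abs_sub_le {f g : ℝ → ℝ} (h : HasWeakDeriv f g) (hf : Continuous f)
    {M lam a b : ℝ} (hM : 0 ≤ M) (hlam : 0 < lam) (hab : a ≤ b)
    (hg : ∫⁻ x, ENNReal.ofReal (g x ^ 2) ≤ ENNReal.ofReal M) :
    |f b - f a| ≤ lam * M + (b - a) / (4 * lam) := by
  refine le_of_forall_pos_le_add fun ε hε => ?_
  obtain ⟨δa, ha0, ha⟩ := Metric.continuous_iff.1 hf a (ε / 3) (by positivity)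
  obtain ⟨δb, hb0, hb⟩ := Metric.continuous_iff.1 hf b (ε / 3) (by positivity)
  obtain ⟨δ, hδ, hδa, hδb, hδε⟩ : ∃ δ > 0, δ < δa ∧ δ < δb ∧ δ ≤ ε / 3 * (4 * lam) := by
    refine ⟨min (min (δa / 2) (δb / 2)) (ε / 3 * (4 * lam)), by positivity, ?_, ?_, min_le_right _ _⟩
    · exact ((min_le_left _ _).trans (min_le_left _ _)).trans_lt (by linarith)
    · exact ((min_le_left _ _).trans (min_le_right _ _)).trans_lt (by linarith)
  set φ : ℝ → ℝ := fun x => smoothStep δ a x - smoothStep δ b x with hφ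
  have hsupp : ∀ x ∉ Icc a (b + δ), φ x = 0 := by
    intro x hx
    have h : x < a ∨ b + δ < x := by
      by_contra! h
      exact hx h
    rcases h with h | h
    · simp only [hφ]
      rw [smoothStep_of_le hδ h.le, smoothStep_of_le hδ (by linarith), sub_zero]
    · simp only [hφ]
      rw [smoothStep_of_ge hδ (by linarith), smoothStep_of_ge hδ h.le, sub_self]
  have hder : deriv φ = fun x => stepKernel δ a x - stepKernel δ b x := by
    funext x
    exact deriv_fun_sub (differentiable_smoothStep δ a x) (differentiable_smoothStep δ b x)
  have hweak := h.2.2 φ ((contDiff_smoothStep δ a).sub (contDiff_smoothStep δ b))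
    (HasCompactSupport.intro isCompact_Icc hsupp)
  rw [hder] at hweak
  simp_rw [mul_sub] at hweak
  rw [integral_sub (integrable_mul_stepKernel hf hδ a) (integrable_mul_stepKernel hf hδ b)]
    at hweak
  have hle := abs_integral_mul_le_of_sq hM hlam (by linarith : a ≤ b + δ) hg (φ := φ)
    (fun x => by
      have := smoothStep_nonneg δ a x
      have := smoothStep_nonneg δ b x
      have := smoothStep_le_one δ a x
      have := smoothStep_le_one δ b x
      rw [abs_le]
      constructor <;> simp only [hφ] <;> linarith) hsupp
  have hma := abs_integral_mul_stepKernel_sub_le hf (a := a) hδ (ε := ε / 3) fun x hx =>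
    (ha x (by rw [Real.dist_eq, abs_of_nonneg (by linarith [hx.1])]; linarith [hx.2])).le
  have hmb := abs_integral_mul_stepKernel_sub_le hf (a := b) hδ (ε := ε / 3) fun x hx =>
    (hb x (by rw [Real.dist_eq, abs_of_nonneg (by linarith [hx.1])]; linarith [hx.2])).le
  have hdiv : (b + δ - a) / (4 * lam) ≤ (b - a) / (4 * lam) + ε / 3 := by
    rw [div_add' _ _ _ (by positivity)]
    gcongr
    linarith
  rw [abs_le] at *
  constructor <;> linarith [hma.1, hma.2, hmb.1, hmb.2, hle.1, hle.2]

/-! ### Powers and the relative entropy on bounded sets -/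

theorem exists_le_abs_rpow_sub_rpow {p R ε : ℝ} (hp : 0 < p) (hε : 0 < ε) :
    ∃ c > 0, ∀ r ∈ Icc 0 R, ∀ s ∈ Icc 0 R, ε ≤ |r - s| → c ≤ |r ^ p - s ^ p| := by
  have hK : IsCompact ((Icc 0 R ×ˢ Icc 0 R) ∩ {z : ℝ × ℝ | ε ≤ |z.1 - z.2|}) :=
    (isCompact_Icc.prod isCompact_Icc).inter_right
      (isClosed_le continuous_const (by fun_prop))
  have hc : Continuous fun z : ℝ × ℝ => |z.1 ^ p - z.2 ^ p| :=
    ((continuous_fst.rpow_const fun _ => Or.inr hp.le).sub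
      (continuous_snd.rpow_const fun _ => Or.inr hp.le)).abs
  obtain ⟨c, hc0, h⟩ := hK.exists_forall_le' hc.continuousOn (a := 0) (by
    rintro ⟨r, s⟩ ⟨⟨hr, hs⟩, hrs⟩
    simp only [mem_ofPred_eq] at hr hs hrs
    rw [abs_pos, sub_ne_zero, Ne, Real.rpow_left_inj hr.1 hs.1 hp.ne']
    rintro rfl
    simp only [sub_self, abs_zero] at hrs
    linarith)
  exact ⟨c, hc0, fun r hr s hs hrs => h (r, s) ⟨⟨hr, hs⟩, hrs⟩⟩

theorem exists_abs_rpow_sub_rpow_lt {p R ε : ℝ} (hp : 0 < p) (hε : 0 < ε) :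
    ∃ κ > 0, ∀ r ∈ Icc 0 R, ∀ s ∈ Icc 0 R, |r - s| < κ → |r ^ p - s ^ p| < ε := by
  have hc : Continuous fun r : ℝ => r ^ p := continuous_id.rpow_const fun _ => Or.inr hp.le
  exact Metric.uniformContinuousOn_iff.1
    ((isCompact_Icc (a := 0) (b := R)).uniformContinuousOn_of_continuous hc.continuousOn) ε hε

/-- The relative entropy `r^γ - s^γ - γ s^(γ-1) (r - s)`. -/
noncomputable def relativeEntropy (γ r s : ℝ) : ℝ := r ^ γ - s ^ γ - γ * s ^ (γ - 1) * (r - s)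

theorem relativeEntropy_self (γ r : ℝ) : relativeEntropy γ r r = 0 := by
  simp [relativeEntropy]

theorem relativeEntropy_pos {γ r s : ℝ} (hγ : 1 < γ) (hr : 0 ≤ r) (hs : 0 < s) (hrs : r ≠ s) :
    0 < relativeEntropy γ r s := by
  have h := one_add_mul_self_lt_rpow_one_add (s := r / s - 1)
    (by linarith [div_nonneg hr hs.le])
    (by rw [sub_ne_zero, Ne, div_eq_one_iff_eq hs.ne']; exact hrs) hγ
  rw [add_sub_cancel, Real.div_rpow hr hs.le, lt_div_iff₀ (by positivity)] at h
  rw [relativeEntropy, Real.rpow_sub_one hs.ne']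
  have e : (1 + γ * (r / s - 1)) * s ^ γ = s ^ γ + γ * (s ^ γ / s) * (r - s) := by
    field_simp
  linarith

theorem relativeEntropy_nonneg {γ r s : ℝ} (hγ : 1 < γ) (hr : 0 ≤ r) (hs : 0 < s) :
    0 ≤ relativeEntropy γ r s := by
  rcases eq_or_ne r s with rfl | h
  · exact (relativeEntropy_self γ r).ge
  · exact (relativeEntropy_pos hγ hr hs h).le

theorem exists_le_relativeEntropy {γ R a b κ : ℝ} (hγ : 1 < γ) (ha : 0 < a) (hκ : 0 < κ) :
    ∃ c > 0, ∀ r ∈ Icc 0 R, ∀ s ∈ Icc a b, κ ≤ |r - s| → c ≤ relativeEntropy γ r s := by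
  have hK : IsCompact ((Icc 0 R ×ˢ Icc a b) ∩ {z : ℝ × ℝ | κ ≤ |z.1 - z.2|}) :=
    (isCompact_Icc.prod isCompact_Icc).inter_right
      (isClosed_le continuous_const (by fun_prop))
  have hc : Continuous fun z : ℝ × ℝ => relativeEntropy γ z.1 z.2 := by
    have h1 : Continuous fun z : ℝ × ℝ => z.1 ^ γ :=
      continuous_fst.rpow_const fun _ => Or.inr (by linarith)
    have h2 : Continuous fun z : ℝ × ℝ => z.2 ^ γ :=
      continuous_snd.rpow_const fun _ => Or.inr (by linarith)
    have h3 : Continuous fun z : ℝ × ℝ => z.2 ^ (γ - 1) :=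
      continuous_snd.rpow_const fun _ => Or.inr (by linarith)
    unfold relativeEntropy
    fun_prop
  obtain ⟨c, hc0, h⟩ := hK.exists_forall_le' hc.continuousOn (a := 0) (by
    rintro ⟨r, s⟩ ⟨⟨hr, hs⟩, hrs⟩
    simp only [mem_ofPred_eq] at hr hs hrs
    refine relativeEntropy_pos hγ hr.1 (ha.trans_le hs.1) fun (h : r = s) => ?_
    simp only [h, sub_self, abs_zero] at hrs
    linarith)
  exact ⟨c, hc0, fun r hr s hs hrs => h (r, s) ⟨⟨hr, hs⟩, hrs⟩⟩

/-! ### Bounds for the rarefaction wave -/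

theorem sigma2_lt_lambda2 {γ r : ℝ} (hγ : 1 < γ) (hr : 0 < r) (v : ℝ) :
    sigma2 γ r v < lambda2 γ r v := by
  rw [sigma2_eq hγ hr, lambda2, sqrt_pressure' hγ hr.le]
  have h1 : 0 < γ - 1 := by linarith
  have h3 : 0 < √γ := Real.sqrt_pos.2 (by linarith)
  have : 0 < √γ * (2 / (γ - 1)) * r ^ ((γ - 1) / 2) := by positivity
  have : 0 < √γ * r ^ ((γ - 1) / 2) := by positivity
  linarith

theorem abs_burgersInit_sub_le {q : ℝ} (hq : 2 ≤ q) (η wm wp x y : ℝ) :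
    |burgersInit q η wm wp x - burgersInit q η wm wp y| ≤
      |(wp - wm) / 2 * burgersK q * η| * |x - y| := by
  have hi := fun a b => (continuous_burgersKernel q).intervalIntegrable (μ := volume) a b
  have h : |∫ s in (η * y)..(η * x), (1 + s ^ 2) ^ (-q)| ≤ 1 * |η * x - η * y| := by
    rw [← Real.norm_eq_abs]
    refine intervalIntegral.norm_integral_le_of_norm_le_const fun s _ => ?_
    have h0 : (0 : ℝ) < 1 + s ^ 2 := by positivity
    rw [Real.norm_of_nonneg (Real.rpow_nonneg h0.le _)]
    exact Real.rpow_le_one_of_one_le_of_nonpos (by linarith [sq_nonneg s]) (by linarith)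
  have e : burgersInit q η wm wp x - burgersInit q η wm wp y =
      (wp - wm) / 2 * burgersK q * ∫ s in (η * y)..(η * x), (1 + s ^ 2) ^ (-q) := by
    rw [← intervalIntegral.integral_interval_sub_left (hi 0 (η * x)) (hi 0 (η * y))]
    unfold burgersInit
    ring
  rw [e, abs_mul, abs_mul _ η, mul_assoc, ← abs_mul η, mul_sub]
  exact mul_le_mul_of_nonneg_left (by linarith) (abs_nonneg _)

theorem abs_burgersFoot_sub_le {q η wm wp t : ℝ} (hq : 2 ≤ q) (hη : 0 < η) (hw : wm ≤ wp)
    (ht : 0 ≤ t) (x y : ℝ) :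
    |burgersFoot q η wm wp t x - burgersFoot q η wm wp t y| ≤ |x - y| := by
  wlog h : burgersFoot q η wm wp t y ≤ burgersFoot q η wm wp t x generalizing x y
  · rw [abs_sub_comm, abs_sub_comm x]
    exact this y x (le_of_not_ge h)
  have hx := (burgersFoot_iff hq hη hw ht x _).1 rfl
  have hy := (burgersFoot_iff hq hη hw ht y _).1 rfl
  have hm := mul_le_mul_of_nonneg_right (monotone_burgersInit hq hη hw h) ht
  rw [abs_of_nonneg (by linarith)]
  exact le_trans (by linarith) (le_abs_self _)

theorem continuous_invertDensity {γ : ℝ} (hγ : 1 < γ) (S : ℝ) :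
    Continuous fun w => invertDensity γ w S := by
  unfold invertDensity
  exact Continuous.rpow_const (by fun_prop)
    fun _ => Or.inr (div_nonneg zero_le_two (by linarith))

theorem rarefactionDensity_equicontinuous {γ q η rm um rp up : ℝ} (hγ : 1 < γ) (hq : 2 ≤ q)
    (hη : 0 < η) (hlambda : lambda2 γ rm um < lambda2 γ rp up) {ε : ℝ} (hε : 0 < ε) :
    ∃ δ > 0, ∀ t ≥ 0, ∀ x y, |x - y| < δ →
      |rarefactionDensity γ q η rm um rp up t x - rarefactionDensity γ q η rm um rp up t y| < ε := by
  obtain ⟨κ, hκ, h⟩ := Metric.uniformContinuousOn_iff.1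
    ((isCompact_Icc (a := lambda2 γ rm um) (b := lambda2 γ rp up)).uniformContinuousOn_of_continuous
      (continuous_invertDensity hγ (sigma2 γ rm um)).continuousOn) ε hε
  set c := |(lambda2 γ rp up - lambda2 γ rm um) / 2 * burgersK q * η|
  have hc : 0 ≤ c := abs_nonneg _
  refine ⟨κ / (c + 1), by positivity, fun t ht x y hxy => ?_⟩
  refine h _ (burgersWave_mem hq hlambda.le _ _) _ (burgersWave_mem hq hlambda.le _ _) ?_
  rw [lt_div_iff₀ (by positivity)] at hxy
  calc |burgersWave q η _ _ (1 + t) x - burgersWave q η _ _ (1 + t) y| ≤ c * |_| :=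
        abs_burgersInit_sub_le hq η _ _ _ _
    _ ≤ c * |x - y| := mul_le_mul_of_nonneg_left
        (abs_burgersFoot_sub_le hq hη hlambda.le (by linarith) x y) hc
    _ ≤ |x - y| * (c + 1) := by linarith [abs_nonneg (x - y)]
    _ < κ := hxy

theorem exists_rarefactionDensity_mem {γ q : ℝ} (η : ℝ) {rm um rp up : ℝ} (hγ : 1 < γ) (hq : 2 ≤ q)
    (hrm : 0 < rm) (hlambda : lambda2 γ rm um < lambda2 γ rp up) :
    ∃ a b, 0 < a ∧ ∀ t x, rarefactionDensity γ q η rm um rp up t x ∈ Icc a b := by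
  have hc := (continuous_invertDensity hγ (sigma2 γ rm um)).continuousOn
    (s := Icc (lambda2 γ rm um) (lambda2 γ rp up))
  obtain ⟨a, ha, h⟩ := isCompact_Icc.exists_forall_le' hc fun w hw =>
    invertDensity_pos hγ ((sigma2_lt_lambda2 hγ hrm um).trans_le hw.1)
  obtain ⟨b, hb⟩ := isCompact_Icc.exists_bound_of_continuousOn hc
  exact ⟨a, b, ha, fun t x => ⟨h _ (burgersWave_mem hq hlambda.le _ _),
    (le_abs_self _).trans (hb _ (burgersWave_mem hq hlambda.le _ _))⟩⟩

theorem exists_abs_rarefactionVelocity_le {γ q : ℝ} (η : ℝ) {rm um rp up : ℝ} (hq : 2 ≤ q)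
    (hlambda : lambda2 γ rm um < lambda2 γ rp up) :
    ∃ K, ∀ t x, |rarefactionVelocity γ q η rm um rp up t x| ≤ K := by
  have hc : Continuous fun w => invertVelocity γ w (sigma2 γ rm um) := by
    unfold invertVelocity
    fun_prop
  obtain ⟨K, hK⟩ := isCompact_Icc.exists_bound_of_continuousOn
    (s := Icc (lambda2 γ rm um) (lambda2 γ rp up)) hc.continuousOn
  exact ⟨K, fun t x => hK _ (burgersWave_mem hq hlambda.le _ _)⟩

/-! ### Bounds on the half line from bounds on bounded intervals -/

theorem ae_le_of_forall_essSup_le {g : ℝ → ℝ≥0∞} {c : ℝ≥0∞}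
    (h : ∀ T > 0, essSup g (volume.restrict (Ioo 0 T)) ≤ c) :
    ∀ᵐ t ∂volume.restrict (Ioi (0 : ℝ)), g t ≤ c := by
  have e : Ioi (0 : ℝ) = ⋃ n : ℕ, Ioo 0 ((n : ℝ) + 1) := by
    ext t
    simp only [mem_Ioi, mem_iUnion, mem_Ioo, exists_and_left, iff_self_and]
    intro _
    obtain ⟨n, hn⟩ := exists_nat_gt t
    exact ⟨n, by linarith⟩
  rw [e, ae_restrict_iUnion_iff]
  intro n
  filter_upwards [ae_le_essSup (f := g) (μ := volume.restrict (Ioo 0 ((n : ℝ) + 1)))] with t ht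
  exact ht.trans (h _ (by positivity))

theorem setLIntegral_Ioi_le_of_forall {g : ℝ → ℝ≥0∞} {c : ℝ≥0∞}
    (h : ∀ T > 0, ∫⁻ t in Ioo 0 T, g t ≤ c) : ∫⁻ t in Ioi (0 : ℝ), g t ≤ c := by
  have e : Ioi (0 : ℝ) = ⋃ n : ℕ, Ioo 0 ((n : ℝ) + 1) := by
    ext t
    simp only [mem_Ioi, mem_iUnion, mem_Ioo, exists_and_left, iff_self_and]
    intro _
    obtain ⟨n, hn⟩ := exists_nat_gt t
    exact ⟨n, by linarith⟩
  rw [e, setLIntegral_iUnion_of_directed]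
  · exact iSup_le fun n => h _ (by positivity)
  · refine Monotone.directed_le fun m n hmn => Ioo_subset_Ioo_right ?_
    have : (m : ℝ) ≤ n := by exact_mod_cast hmn
    linarith

theorem tendsto_setLIntegral_Ioi_zero {g : ℝ → ℝ≥0∞} {a : ℝ} (h : ∫⁻ t in Ioi a, g t ≠ ⊤) :
    Tendsto (fun T => ∫⁻ t in Ioi T, g t) atTop (𝓝 0) := by
  have h1 := tendsto_measure_iInter_atTop (μ := volume.withDensity g) (s := fun T : ℝ => Ioi T)
    (fun T => measurableSet_Ioi.nullMeasurableSet) (fun _ _ hst => Ioi_subset_Ioi hst)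
    ⟨a, by rwa [withDensity_apply _ measurableSet_Ioi]⟩
  have e : ⋂ T : ℝ, Ioi T = ∅ := by
    ext t
    simp only [mem_iInter, mem_Ioi, mem_empty_iff_false, iff_false, not_forall]
    exact ⟨t, lt_irrefl t⟩
  rw [e, measure_empty] at h1
  refine h1.congr fun T => ?_
  rw [Function.comp_apply, withDensity_apply _ measurableSet_Ioi]

/-- An inequality that holds almost everywhere on the half line holds everywhere there, by
continuity. -/
theorem le_of_ae_le_of_continuousOn {g : ℝ → ℝ} {c : ℝ} (hg : ContinuousOn g (Ioi 0))
    (h : ∀ᵐ t ∂volume.restrict (Ioi (0 : ℝ)), g t ≤ c) {t : ℝ} (ht : 0 < t) : g t ≤ c := by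
  by_contra! hlt
  rw [ae_restrict_iff' measurableSet_Ioi] at h
  have h1 : {s | c < g s ∧ s ∈ Ioi (0 : ℝ)} ∈ 𝓝 t := by
    filter_upwards [(hg.continuousAt (Ioi_mem_nhds ht)).eventually (lt_mem_nhds hlt),
      Ioi_mem_nhds ht] with s h1 h2 using ⟨h1, h2⟩
  have h2 := Measure.measure_pos_of_mem_nhds volume h1
  refine h2.ne' (measure_mono_null (fun s hs => ?_) h)
  intro (h3 : s ∈ Ioi (0 : ℝ) → g s ≤ c)
  exact absurd (h3 hs.2) (not_le.2 hs.1)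

/-! ### Equicontinuity of the density -/

theorem continuous_slice {rho : ℝ → ℝ → ℝ}
    (hcont : ContinuousOn (Function.uncurry rho) (Ioi (0 : ℝ) ×ˢ (univ : Set ℝ))) {t : ℝ}
    (ht : 0 < t) : Continuous (rho t) := by
  rw [← continuousOn_univ]
  exact hcont.comp (f := fun x => (t, x)) (by fun_prop) fun x _ => ⟨ht, mem_univ x⟩

theorem continuousOn_time {rho : ℝ → ℝ → ℝ}
    (hcont : ContinuousOn (Function.uncurry rho) (Ioi (0 : ℝ) ×ˢ (univ : Set ℝ))) (x : ℝ) :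
    ContinuousOn (fun t => rho t x) (Ioi 0) :=
  hcont.comp (f := fun t => (t, x)) (by fun_prop) fun _ ht => ⟨ht, mem_univ x⟩

/-- A uniform `L²` bound for the weak space derivative of a power makes a bounded density
equicontinuous in space. -/
theorem equicontinuous_space {rho D : ℝ → ℝ → ℝ} {p R M : ℝ} (hp : 0 < p) (hM : 0 ≤ M)
    (hcont : ContinuousOn (Function.uncurry rho) (Ioi (0 : ℝ) ×ˢ (univ : Set ℝ)))
    (hrho : ∀ t > 0, ∀ x, rho t x ∈ Icc 0 R)
    (hD : HasWeakSpaceDeriv (fun t x => rho t x ^ p) D)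
    (hDM : ∀ᵐ t ∂volume.restrict (Ioi (0 : ℝ)),
      ∫⁻ x, ENNReal.ofReal (D t x ^ 2) ≤ ENNReal.ofReal M) {ε : ℝ} (hε : 0 < ε) :
    ∃ δ > 0, ∀ t > 0, ∀ x y, |x - y| < δ → |rho t x - rho t y| < ε := by
  obtain ⟨c, hc, hsep⟩ := exists_le_abs_rpow_sub_rpow (R := R) hp hε
  set lam := c / (4 * (M + 1)) with hlam
  have hlam0 : 0 < lam := by positivity
  have hpow : Continuous fun r : ℝ => r ^ p := continuous_id.rpow_const fun _ => Or.inr hp.le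
  have key : ∀ t > 0, ∀ x y, x ≤ y → |rho t y ^ p - rho t x ^ p| ≤ lam * M + (y - x) / (4 * lam) := by
    intro t ht x y hxy
    refine le_of_ae_le_of_continuousOn (g := fun t => |rho t y ^ p - rho t x ^ p|) ?_ ?_ ht
    · exact ((hpow.comp_continuousOn (continuousOn_time hcont y)).sub
        (hpow.comp_continuousOn (continuousOn_time hcont x))).abs
    · filter_upwards [hD.2, hDM, ae_restrict_mem measurableSet_Ioi] with s h1 h2 h3
      exact h1.abs_sub_le (hpow.comp (continuous_slice hcont h3)) hM hlam0 hxy h2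
  refine ⟨c * lam, by positivity, fun t ht x y hxy => ?_⟩
  wlog h : x ≤ y generalizing x y
  · rw [abs_sub_comm]
    exact this y x (by rwa [abs_sub_comm]) (le_of_not_ge h)
  by_contra! hcon
  have h1 := hsep _ (hrho t ht x) _ (hrho t ht y) hcon
  have h2 := key t ht x y h
  rw [abs_sub_comm, abs_of_nonneg (by linarith)] at hxy
  rw [abs_sub_comm] at h1
  have h3 : (y - x) / (4 * lam) ≤ c / 4 := by
    rw [div_le_iff₀ (by positivity)]
    linarith
  have h4 : lam * M ≤ c / 4 := by
    have : lam * (M + 1) = c / 4 := by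
      rw [hlam]
      field_simp
    linarith
  linarith

/-- The mass equation, tested against a function of `x` alone. -/
theorem IsWeakSolution.mass_of_space {γ α : ℝ} {rhobar ubar rho u : ℝ → ℝ → ℝ} {rho0 m0 : ℝ → ℝ}
    (hsol : IsWeakSolution γ α rhobar ubar rho0 m0 rho u) {φ : ℝ → ℝ} (hφ : ContDiff ℝ 1 φ)
    (hφc : HasCompactSupport φ) {t₁ t₂ : ℝ} (h1 : 0 ≤ t₁) (h12 : t₁ ≤ t₂) :
    (∫ x, (rho t₂ x - rhobar t₂ x) * φ x) - (∫ x, (rho t₁ x - rhobar t₁ x) * φ x) =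
      ∫ t in t₁..t₂, ∫ x, (rho t x * u t x - rhobar t x * ubar t x) * deriv φ x := by
  set χ : ContDiffBump ((t₁ + t₂) / 2) :=
    ⟨(t₂ - t₁) / 2 + 1, (t₂ - t₁) / 2 + 2, by linarith, by linarith⟩ with hχ
  have hball : ∀ t ∈ Icc t₁ t₂, t ∈ Metric.ball ((t₁ + t₂) / 2) χ.rIn := by
    intro t ht
    rw [Metric.mem_ball, Real.dist_eq, abs_lt]
    constructor <;> simp only [hχ] <;> linarith [ht.1, ht.2]
  have hone : ∀ t ∈ Icc t₁ t₂, χ t = 1 := fun t ht =>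
    χ.one_of_mem_closedBall (Metric.ball_subset_closedBall (hball t ht))
  have hder : ∀ t ∈ Icc t₁ t₂, deriv χ t = 0 := fun t ht => by
    have : χ =ᶠ[𝓝 t] fun _ => (1 : ℝ) := by
      filter_upwards [Metric.isOpen_ball.mem_nhds (hball t ht)] with s hs
      exact χ.one_of_mem_closedBall (Metric.ball_subset_closedBall hs)
    rw [this.deriv_eq, deriv_const]
  have h := hsol.mass t₁ t₂ h1 h12 (fun t x => χ t * φ x) (by
      have hχc : ContDiff ℝ 1 χ := χ.contDiff
      exact (hχc.comp contDiff_fst).mul (hφ.comp contDiff_snd)) (by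
      refine HasCompactSupport.intro (χ.hasCompactSupport.isCompact.prod hφc.isCompact) ?_
      rintro ⟨t, x⟩ htx
      simp only [mem_prod, not_and_or] at htx
      rcases htx with htx | htx
      · simp [Function.uncurry, image_eq_zero_of_notMem_tsupport htx]
      · simp [Function.uncurry, image_eq_zero_of_notMem_tsupport htx])
  simp only [hone t₁ ⟨le_rfl, h12⟩, hone t₂ ⟨h12, le_rfl⟩, one_mul] at h
  rw [h]
  refine intervalIntegral.integral_congr fun t ht => ?_
  rw [uIcc_of_le h12] at ht
  refine integral_congr_ae (Eventually.of_forall fun x => ?_)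
  simp [hone t ht, hder t ht, deriv_mul_const_field]

/-- The mass flux difference is bounded in the dual of the compactly supported Lipschitz
functions. -/
theorem abs_integral_flux_le {r rb v vb φ : ℝ → ℝ} {R N K B C a δ : ℝ} (hB : 0 ≤ B) (hC : 0 ≤ C)
    (hδ : 0 ≤ δ)
    (hr : ∀ x, r x ∈ Icc 0 R) (hN : ∀ x, |r x - rb x| ≤ N) (hK : ∀ x, |vb x| ≤ K)
    (hE : ∫⁻ x, ENNReal.ofReal ((√(r x) * (v x - vb x)) ^ 2) ≤ ENNReal.ofReal C)
    (hφ : ∀ x, |φ x| ≤ B) (hs : ∀ x ∉ Icc a (a + δ), φ x = 0) :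
    |∫ x, (r x * v x - rb x * vb x) * φ x| ≤ C + (R * B ^ 2 + N * K * B) * δ := by
  have hR : 0 ≤ R := (hr 0).1.trans (hr 0).2
  have hN0 : 0 ≤ N := (abs_nonneg _).trans (hN 0)
  have hK0 : 0 ≤ K := (abs_nonneg _).trans (hK 0)
  set L := R * B ^ 2 + N * K * B
  have hL : 0 ≤ L := by positivity
  have hbound : ∀ x, ‖(r x * v x - rb x * vb x) * φ x‖ₑ ≤
      ENNReal.ofReal ((√(r x) * (v x - vb x)) ^ 2) +
        (Icc a (a + δ)).indicator (fun _ => ENNReal.ofReal L) x := by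
    intro x
    by_cases hx : x ∈ Icc a (a + δ)
    · rw [indicator_of_mem hx, ← ENNReal.ofReal_add (by positivity) hL, ← ofReal_norm]
      refine ENNReal.ofReal_le_ofReal ?_
      have hq := Real.mul_self_sqrt (hr x).1
      set z := √(r x)
      set A := z * (v x - vb x) with hA
      have e : (r x * v x - rb x * vb x) * φ x = A * (z * φ x) + (r x - rb x) * vb x * φ x := by
        rw [hA, ← hq]
        ring
      have h1 : |A * (z * φ x)| ≤ A ^ 2 + R * B ^ 2 := by
        have hz : (z * φ x) ^ 2 ≤ R * B ^ 2 := by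
          rw [mul_pow, sq z, hq, ← sq_abs (φ x)]
          exact mul_le_mul (hr x).2 (pow_le_pow_left₀ (abs_nonneg _) (hφ x) 2) (by positivity) hR
        rw [abs_le]
        constructor <;> nlinarith [sq_nonneg (A + z * φ x), sq_nonneg (A - z * φ x), sq_nonneg A]
      have h2 : |(r x - rb x) * vb x * φ x| ≤ N * K * B := by
        rw [abs_mul, abs_mul]
        exact mul_le_mul (mul_le_mul (hN x) (hK x) (abs_nonneg _) hN0) (hφ x) (abs_nonneg _)
          (by positivity)
      rw [e, Real.norm_eq_abs]
      exact (abs_add_le _ _).trans (by linarith)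
    · simp [hs x hx]
  have h : ‖∫ x, (r x * v x - rb x * vb x) * φ x‖ₑ ≤ ENNReal.ofReal (C + L * δ) := by
    calc ‖∫ x, (r x * v x - rb x * vb x) * φ x‖ₑ
        ≤ ∫⁻ x, ‖(r x * v x - rb x * vb x) * φ x‖ₑ := enorm_integral_le_lintegral_enorm _
      _ ≤ ∫⁻ x, (ENNReal.ofReal ((√(r x) * (v x - vb x)) ^ 2) +
            (Icc a (a + δ)).indicator (fun _ => ENNReal.ofReal L) x) := lintegral_mono hbound
      _ = (∫⁻ x, ENNReal.ofReal ((√(r x) * (v x - vb x)) ^ 2)) +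
            ENNReal.ofReal L * ENNReal.ofReal δ := by
        rw [lintegral_add_right _ (measurable_const.indicator measurableSet_Icc),
          lintegral_indicator measurableSet_Icc, setLIntegral_const, Real.volume_Icc,
          add_sub_cancel_left]
      _ ≤ ENNReal.ofReal C + ENNReal.ofReal L * ENNReal.ofReal δ := by gcongr
      _ = ENNReal.ofReal (C + L * δ) := by
        rw [← ENNReal.ofReal_mul hL, ← ENNReal.ofReal_add hC (by positivity)]
  rw [← ofReal_norm] at h
  exact (ENNReal.ofReal_le_ofReal_iff (by positivity)).1 h

/-- Equicontinuity in space and the mass equation give equicontinuity in time. -/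
theorem equicontinuous_time {γ α : ℝ} {rhobar ubar rho u : ℝ → ℝ → ℝ} {rho0 m0 : ℝ → ℝ}
    (hsol : IsWeakSolution γ α rhobar ubar rho0 m0 rho u) {R N K C : ℝ} (hC : 0 ≤ C)
    (hrho : ∀ t > 0, ∀ x, rho t x ∈ Icc 0 R) (hN : ∀ t > 0, ∀ x, |rho t x - rhobar t x| ≤ N)
    (hK : ∀ t x, |ubar t x| ≤ K)
    (hc : ∀ t > 0, Continuous fun x => rho t x - rhobar t x)
    (hE : ∀ᵐ t ∂volume.restrict (Ioi (0 : ℝ)),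
      ∫⁻ x, ENNReal.ofReal ((√(rho t x) * (u t x - ubar t x)) ^ 2) ≤ ENNReal.ofReal C)
    (hequi : ∀ ε > 0, ∃ δ > 0, ∀ t > 0, ∀ x y, |x - y| < δ →
      |(rho t x - rhobar t x) - (rho t y - rhobar t y)| < ε) {ε : ℝ} (hε : 0 < ε) :
    ∃ δ > 0, ∀ s > 0, ∀ t, s ≤ t → t < s + δ → ∀ x,
      |(rho t x - rhobar t x) - (rho s x - rhobar s x)| < ε := by
  obtain ⟨d, hd, hd'⟩ := hequi (ε / 3) (by positivity)
  have hd2 : 0 < d / 2 := by positivity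
  obtain ⟨B, hB⟩ := exists_bound_deriv_stepKernel hd2
  have hB0 : 0 ≤ B := (abs_nonneg _).trans (hB 0 0)
  have hR : 0 ≤ R := (hrho 1 one_pos 0).1.trans (hrho 1 one_pos 0).2
  have hN0 : 0 ≤ N := (abs_nonneg _).trans (hN 1 one_pos 0)
  have hK0 : 0 ≤ K := (abs_nonneg _).trans (hK 0 0)
  set L := C + (R * B ^ 2 + N * K * B) * (d / 2) with hL
  have hL0 : 0 ≤ L := by positivity
  refine ⟨ε / (3 * (L + 1)), by positivity, fun s hs t hst hts x => ?_⟩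
  have hk := contDiff_stepKernel (d / 2) x
  have hmass := hsol.mass_of_space (hk.of_le (by simp)) (hasCompactSupport_stepKernel hd2 x)
    hs.le hst
  have hflux : ‖∫ τ in s..t, ∫ y, (rho τ y * u τ y - rhobar τ y * ubar τ y) *
      deriv (stepKernel (d / 2) x) y‖ ≤ L * |t - s| := by
    refine intervalIntegral.norm_integral_le_of_norm_le_const_ae ?_
    filter_upwards [(ae_restrict_iff' measurableSet_Ioi).1 hE] with τ hτ hmem
    rw [uIoc_of_le hst] at hmem
    have hτ0 : 0 < τ := hs.trans hmem.1
    exact abs_integral_flux_le hB0 hC hd2.le (hrho τ hτ0) (hN τ hτ0) (hK τ) (hτ hτ0) (hB x)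
      fun y hy => deriv_stepKernel_eq_zero hd2 hy
  rw [← hmass, abs_of_nonneg (by linarith), Real.norm_eq_abs] at hflux
  have hosc : ∀ τ > 0, |(∫ y, (rho τ y - rhobar τ y) * stepKernel (d / 2) x y) -
      (rho τ x - rhobar τ x)| ≤ ε / 3 := fun τ hτ =>
    abs_integral_mul_stepKernel_sub_le (hc τ hτ) hd2 fun y hy => (hd' τ hτ y x (by
      rw [abs_of_nonneg (by linarith [hy.1])]
      linarith [hy.2])).le
  have h1 := abs_le.1 (hosc s hs)
  have h2 := abs_le.1 (hosc t (hs.trans_le hst))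
  have h3 : L * (t - s) < ε / 3 := by
    have h4 : (t - s) * (3 * (L + 1)) < ε := by
      rw [← lt_div_iff₀ (by positivity)]
      linarith
    rcases hst.eq_or_lt with rfl | hlt
    · simpa using (by positivity : 0 < ε / 3)
    · linarith
  have h5 := abs_le.1 hflux
  rw [abs_lt]
  constructor <;> linarith [h1.1, h1.2, h2.1, h2.2, h5.1, h5.2]

/-! ### Decay of the perturbation -/

/-- A perturbation of bounded relative entropy that is not small at one point has a gradient which
is not small in `L²`. -/
theorem exists_le_lintegral_sq_weakDeriv {γ p a b R C ε : ℝ} (hγ : 1 < γ) (hp : 0 < p)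
    (ha : 0 < a) (hC : 0 ≤ C) (hε : 0 < ε) :
    ∃ m > 0, ∀ r rb g : ℝ → ℝ, Continuous r → Continuous rb → (∀ x, r x ∈ Icc 0 R) →
      (∀ x, rb x ∈ Icc a b) → HasWeakDeriv (fun x => r x ^ p - rb x ^ p) g →
      ∫⁻ x, ENNReal.ofReal (1 / (γ - 1) * relativeEntropy γ (r x) (rb x)) ≤ ENNReal.ofReal C →
      ∀ x, ε ≤ |r x - rb x| → ENNReal.ofReal m ≤ ∫⁻ x, ENNReal.ofReal (g x ^ 2) := by
  have hγ' : 0 < γ - 1 := by linarith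
  obtain ⟨c, hc, hsep⟩ := exists_le_abs_rpow_sub_rpow (R := max R b) hp hε
  obtain ⟨κ, hκ, hclose⟩ := exists_abs_rpow_sub_rpow_lt (R := max R b) hp (half_pos hc)
  obtain ⟨e, he, hent⟩ := exists_le_relativeEntropy (R := R) (b := b) hγ ha hκ
  set L := (C + 1) * (γ - 1) / e with hL
  have hL0 : 0 < L := by positivity
  refine ⟨c ^ 2 / (8 * L), by positivity, fun r rb g hr hrb hrR hrbR hg hE x hx => ?_⟩
  have hmem : ∀ y, r y ∈ Icc 0 (max R b) := fun y =>
    ⟨(hrR y).1, (hrR y).2.trans (le_max_left _ _)⟩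
  have hmemb : ∀ y, rb y ∈ Icc 0 (max R b) := fun y =>
    ⟨ha.le.trans (hrbR y).1, (hrbR y).2.trans (le_max_right _ _)⟩
  obtain ⟨y, hy, hyκ⟩ : ∃ y ∈ Icc x (x + L), |r y - rb y| < κ := by
    by_contra! hcon
    have h1 : ENNReal.ofReal (1 / (γ - 1) * e) * volume (Icc x (x + L)) ≤ ENNReal.ofReal C := by
      rw [← setLIntegral_const]
      refine le_trans ?_ ((setLIntegral_le_lintegral (Icc x (x + L)) _).trans hE)
      refine setLIntegral_mono' measurableSet_Icc fun y hy => ENNReal.ofReal_le_ofReal ?_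
      exact mul_le_mul_of_nonneg_left (hent _ (hrR y) _ (hrbR y) (hcon y hy)) (by positivity)
    rw [Real.volume_Icc, add_sub_cancel_left, ← ENNReal.ofReal_mul (by positivity),
      ENNReal.ofReal_le_ofReal_iff hC] at h1
    have h2 : 1 / (γ - 1) * e * L = C + 1 := by
      rw [hL]
      field_simp
    linarith
  by_contra! hcon
  have hpow : Continuous fun r : ℝ => r ^ p := continuous_id.rpow_const fun _ => Or.inr hp.le
  have h1 := hg.abs_sub_le ((hpow.comp hr).sub (hpow.comp hrb)) (lam := L / c) (by positivity)
    (by positivity) hy.1 hcon.le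
  have h2 := hsep _ (hmem x) _ (hmemb x) hx
  have h3 := hclose _ (hmem y) _ (hmemb y) hyκ
  have h4 : (y - x) / (4 * (L / c)) ≤ c / 4 := by
    rw [div_le_iff₀ (by positivity)]
    have : c / 4 * (4 * (L / c)) = L := by field_simp
    linarith [hy.2]
  have h5 : L / c * (c ^ 2 / (8 * L)) = c / 8 := by field_simp
  have h6 := abs_sub_abs_le_abs_sub (r x ^ p - rb x ^ p) (r y ^ p - rb y ^ p)
  rw [abs_sub_comm (r x ^ p - rb x ^ p)] at h6
  linarith

/-- Convergence to a wave with values in a compact subset of `(0, ∞)` which is equicontinuous in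
space. -/
theorem IsWeakSolution.tendsto_iSup_enorm_sub {γ α : ℝ} (hγ : 1 < γ) (hα : 1 / 2 < α)
    {rhobar ubar rho u : ℝ → ℝ → ℝ} {rho0 m0 : ℝ → ℝ} {a b K : ℝ} (ha : 0 < a)
    (hrhobar : ∀ t x, rhobar t x ∈ Icc a b) (hK : ∀ t x, |ubar t x| ≤ K)
    (hequi : ∀ ε > 0, ∃ δ > 0, ∀ t ≥ 0, ∀ x y, |x - y| < δ → |rhobar t x - rhobar t y| < ε)
    (hsol : IsWeakSolution γ α rhobar ubar rho0 m0 rho u)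
    (hcont : ContinuousOn (Function.uncurry rho) (Ioi (0 : ℝ) ×ˢ (univ : Set ℝ)))
    (hbound : HasUniformBounds γ α rhobar ubar rho u) :
    Tendsto (fun t : ℝ => ⨆ x : ℝ, ‖rho t x - rhobar t x‖ₑ) atTop (𝓝 0) := by
  obtain ⟨C, hrho, D, F, Λ, hD, hF, -, -, hest⟩ := hbound
  have hCe : (C : ℝ≥0∞) = ENNReal.ofReal (C : ℝ) := (ENNReal.ofReal_coe_nnreal).symm
  have hent : ∀ t > 0, ∀ x, 0 ≤ 1 / (γ - 1) * relativeEntropy γ (rho t x) (rhobar t x) :=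
    fun t ht x => mul_nonneg (one_div_nonneg.2 (by linarith))
      (relativeEntropy_nonneg hγ (hrho t ht x).1 (ha.trans_le (hrhobar t x).1))
  have hsum : ∀ᵐ t ∂volume.restrict (Ioi (0 : ℝ)),
      ∫⁻ x, ENNReal.ofReal ((√(rho t x) * (u t x - ubar t x)) ^ 2 + D t x ^ 2
        + 1 / (γ - 1) * relativeEntropy γ (rho t x) (rhobar t x)) ≤ ENNReal.ofReal (C : ℝ) := by
    rw [← hCe]
    exact ae_le_of_forall_essSup_le fun T hT => le_self_add.trans (hest T hT)
  have hpart : ∀ f : ℝ → ℝ → ℝ, (∀ t > 0, ∀ x, f t x ≤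
      (√(rho t x) * (u t x - ubar t x)) ^ 2 + D t x ^ 2
        + 1 / (γ - 1) * relativeEntropy γ (rho t x) (rhobar t x)) →
      ∀ᵐ t ∂volume.restrict (Ioi (0 : ℝ)),
        ∫⁻ x, ENNReal.ofReal (f t x) ≤ ENNReal.ofReal (C : ℝ) := by
    intro f hf
    filter_upwards [hsum, ae_restrict_mem measurableSet_Ioi] with t h1 h2
    exact (lintegral_mono fun x => ENNReal.ofReal_le_ofReal (hf t h2 x)).trans h1
  have hA := hpart (fun t x => (√(rho t x) * (u t x - ubar t x)) ^ 2) fun t ht x => by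
    linarith [hent t ht x, sq_nonneg (D t x)]
  have hD2 := hpart (fun t x => D t x ^ 2) fun t ht x => by
    linarith [hent t ht x, sq_nonneg (√(rho t x) * (u t x - ubar t x))]
  have hR := hpart (fun t x => 1 / (γ - 1) * relativeEntropy γ (rho t x) (rhobar t x))
    fun t ht x => by
      linarith [sq_nonneg (D t x), sq_nonneg (√(rho t x) * (u t x - ubar t x))]
  have hF2 : ∫⁻ t in Ioi (0 : ℝ), ∫⁻ x, ENNReal.ofReal (F t x ^ 2) ≠ ⊤ := by
    refine ne_top_of_le_ne_top (ENNReal.coe_ne_top (r := C)) ?_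
    refine setLIntegral_Ioi_le_of_forall fun T hT => le_trans ?_ (le_add_self.trans (hest T hT))
    refine lintegral_mono fun t => lintegral_mono fun x => ENNReal.ofReal_le_ofReal ?_
    linarith [sq_nonneg (Λ t x)]
  have hbarc : ∀ t > 0, Continuous (rhobar t) := fun t ht => Metric.continuous_iff.2 fun y ε hε => by
    obtain ⟨δ, hδ, h⟩ := hequi ε hε
    exact ⟨δ, hδ, fun x hx => h t (le_of_lt ht) x y hx⟩
  have hspace : ∀ ε > 0, ∃ δ > 0, ∀ t > 0, ∀ x y, |x - y| < δ →
      |(rho t x - rhobar t x) - (rho t y - rhobar t y)| < ε := by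
    intro ε hε
    obtain ⟨δ₁, h1, h1'⟩ := equicontinuous_space (by linarith : 0 < α - 1 / 2) C.2 hcont hrho hD hD2
      (half_pos hε)
    obtain ⟨δ₂, h2, h2'⟩ := hequi (ε / 2) (half_pos hε)
    refine ⟨min δ₁ δ₂, lt_min h1 h2, fun t ht x y hxy => ?_⟩
    have h3 := abs_lt.1 (h1' t ht x y (hxy.trans_le (min_le_left _ _)))
    have h4 := abs_lt.1 (h2' t (le_of_lt ht) x y (hxy.trans_le (min_le_right _ _)))
    rw [abs_lt]
    constructor <;> linarith [h3.1, h3.2, h4.1, h4.2]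
  have hN : ∀ t > 0, ∀ x, |rho t x - rhobar t x| ≤ C + b := fun t ht x => by
    have h1 := hrho t ht x
    have h2 := hrhobar t x
    have h3 := C.2
    rw [abs_le]
    constructor <;> linarith [h1.1, h1.2, h2.1, h2.2]
  have hmain : ∀ ε > 0, ∀ᶠ t in atTop, ∀ x, |rho t x - rhobar t x| ≤ ε := by
    intro ε hε
    obtain ⟨δ, hδ, htime⟩ := equicontinuous_time hsol C.2 hrho hN hK
      (fun t ht => (continuous_slice hcont ht).sub (hbarc t ht)) hA hspace (half_pos hε)
    obtain ⟨m, hm, hgrad⟩ := exists_le_lintegral_sq_weakDeriv (R := C) (b := b) hγ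
      (by linarith : 0 < (γ + α - 1) / 2) ha C.2 (half_pos hε)
    have hsmall := (tendsto_setLIntegral_Ioi_zero hF2).eventually
      (gt_mem_nhds (ENNReal.ofReal_pos.2 (mul_pos hm hδ)))
    filter_upwards [hsmall, eventually_gt_atTop 0] with s hs hs0 x
    by_contra! hcon
    refine absurd hs (not_lt.2 ?_)
    calc ENNReal.ofReal (m * δ) = ∫⁻ _ in Ioo s (s + δ), ENNReal.ofReal m := by
          rw [setLIntegral_const, Real.volume_Ioo, add_sub_cancel_left, ENNReal.ofReal_mul hm.le]
      _ ≤ ∫⁻ t in Ioo s (s + δ), ∫⁻ x, ENNReal.ofReal (F t x ^ 2) := by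
          refine setLIntegral_mono_ae' measurableSet_Ioo ?_
          filter_upwards [(ae_restrict_iff' measurableSet_Ioi).1 hF.2,
            (ae_restrict_iff' measurableSet_Ioi).1 hR] with t h1 h2 ht
          have ht0 : 0 < t := hs0.trans ht.1
          refine hgrad _ _ _ (continuous_slice hcont ht0) (hbarc t ht0) (hrho t ht0) (hrhobar t)
            (h1 ht0) (h2 ht0) x ?_
          have h3 := htime s hs0 t ht.1.le ht.2 x
          have h4 := abs_sub_abs_le_abs_sub (rho s x - rhobar s x) (rho t x - rhobar t x)
          rw [abs_sub_comm] at h3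
          linarith
      _ ≤ ∫⁻ t in Ioi s, ∫⁻ x, ENNReal.ofReal (F t x ^ 2) :=
          lintegral_mono_set Ioo_subset_Ioi_self
  rw [ENNReal.tendsto_nhds_zero]
  intro ε hε
  rcases eq_or_ne ε ⊤ with rfl | hε'
  · exact Eventually.of_forall fun _ => le_top
  filter_upwards [hmain _ (ENNReal.toReal_pos hε.ne' hε')] with t ht
  refine iSup_le fun x => ?_
  rw [← ofReal_norm]
  exact ENNReal.ofReal_le_of_le_toReal (ht x)

end NSRarefaction

theorem theorem2p2 (γ α : ℝ) (hγ : 1 < γ) (hα : 1 / 2 < α)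
    (q η : ℝ) (hq : 2 ≤ q) (hη : 0 < η)
    (rm mm rp mp : ℝ) (hrm : 0 < rm) (hrp : 0 < rp)
    (um up : ℝ) (hum : um = mm / rm) (hup : up = mp / rp)
    (hsigma : NSRarefaction.sigma2 γ rm um = NSRarefaction.sigma2 γ rp up)
    (hlambda : NSRarefaction.lambda2 γ rm um < NSRarefaction.lambda2 γ rp up)
    (rhobar ubar : ℝ → ℝ → ℝ)
    (hrhobar : rhobar = NSRarefaction.rarefactionDensity γ q η rm um rp up)
    (hubar : ubar = NSRarefaction.rarefactionVelocity γ q η rm um rp up)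
    (rho0 m0 : ℝ → ℝ) (rho u : ℝ → ℝ → ℝ)
    (hsol : NSRarefaction.IsWeakSolution γ α rhobar ubar rho0 m0 rho u)
    (hcont : ContinuousOn (Function.uncurry rho) (Set.Ioi (0 : ℝ) ×ˢ (Set.univ : Set ℝ)))
    (hbound : NSRarefaction.HasUniformBounds γ α rhobar ubar rho u) :
    Filter.Tendsto (fun t : ℝ => ⨆ x : ℝ, ‖rho t x - rhobar t x‖ₑ) Filter.atTop (nhds 0) := by
  subst hrhobar hubar
  obtain ⟨a, b, ha, hab⟩ := NSRarefaction.exists_rarefactionDensity_mem η hγ hq hrm hlambda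
  obtain ⟨K, hK⟩ := NSRarefaction.exists_abs_rarefactionVelocity_le η hq hlambda
  exact hsol.tendsto_iSup_enorm_sub hγ hα ha hab hK
    (fun ε hε => NSRarefaction.rarefactionDensity_equicontinuous hγ hq hη hlambda hε) hcont hbound
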